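/- Let $(X_n)_{n\ge 1}$ be a strictly stationary, 1-dependent sequence of real random variables on a probability space, where 1-dependent means that for every $t\ge 1$ the $\sigma$-algebras $\sigma(X_1,\dots,X_t)$ and $\sigma(X_{t+2},X_{t+3},\dots)$ are independent. For $x\in\mathbb R$ and $n\ge 1$ put $q_n=q_n(x)=\mathbb P(\max\{X_1,\dots,X_n\}\le x)$. Let $\alpha>0$ and $x$ be such that $q_1(x)\ge 1-\alpha\ge 0.9$. Let $t_2=t_2(\alpha)$ be the second, in increasing order, of the three real roots of $\alpha t^3-t+1=0$, and let $l=l(\alpha)$ be any real number with $$l>t_2^3,\qquad t_2+(l-t_2^3)<\frac1{\sqrt{3\alpha}} .$$ Put $\eta=1+l\alpha$ and $$K(\alpha)=\frac{\dfrac{11-3\alpha}{(1-\alpha)^2}+2l(1+3\alpha)\dfrac{2+3l\alpha-\alpha(2-l\alpha)(1+l\alpha)^2}{[1-\alpha(1+l\alpha)^2]^3}}{1-\dfrac{2\alpha(1+l\alpha)}{[1-\alpha(1+l\alpha)^2]^2}},$$ $$L(\alpha)=3K(\alpha)(1+\alpha+3\alpha^2)[1+\alpha+3\alpha^2+K(\alpha)\alpha^3]+\alpha^6K(\alpha)^3+9\alpha(4+3\alpha+3\alpha^2)+55,$$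 $$E(\alpha)=0.1+\frac{\eta^5[1+(1-2\alpha)\eta]^4[1+\alpha(\eta-2)][1+\eta+(1-3\alpha)\eta^2]}{2(1-\alpha\eta^2)^4\left[(1-\alpha\eta^2)^2-\alpha\eta^2(1+\eta-2\alpha\eta)^2\right]},\qquad \Gamma(\alpha)=L(\alpha)+E(\alpha).$$ Then for every $n\ge 1$ $$\left|q_n-\frac{2q_1-q_2}{\left[1+q_1-q_2+2(q_1-q_2)^2\right]^n}\right|\le \Delta_2\,(1-q_1)^2,\qquad \Delta_2=3+\Gamma(\alpha)(1-q_1)+n\left[1+K(\alpha)(1-q_1)\right].$$ -/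

import Mathlib

open MeasureTheory ProbabilityTheory

namespace OneDep

/-- Strict stationarity of a real sequence, indexed from `0` (`X 0` is the first variable):
every shifted finite block has the same joint law as the unshifted one. -/
def StrictlyStationary {Ω : Type*} [MeasurableSpace Ω] (P : Measure Ω) (X : ℕ → Ω → ℝ) : Prop :=
  ∀ n k : ℕ, P.map (fun ω => fun i : Fin n => X (k + i) ω) =
    P.map (fun ω => fun i : Fin n => X i ω)

/-- 1-dependence: for every `t ≥ 1`, the sigma-algebra of the first `t` variables
(indices `0, …, t - 1`) is independent of that of all variables with index at least `t + 1`. -/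
def OneDependent {Ω : Type*} [MeasurableSpace Ω] (P : Measure Ω) (X : ℕ → Ω → ℝ) : Prop :=
  ∀ t : ℕ, 1 ≤ t →
    Indep (⨆ i ∈ {i : ℕ | i < t}, MeasurableSpace.comap (X i) inferInstance)
      (⨆ i ∈ {i : ℕ | t + 1 ≤ i}, MeasurableSpace.comap (X i) inferInstance) P

/-- `q_n(x)`: the probability that the maximum of the first `n` variables is at most `x`
(used for `n ≥ 1`). -/
noncomputable def q {Ω : Type*} [MeasurableSpace Ω] (P : Measure Ω) (X : ℕ → Ω → ℝ)
    (x : ℝ) (n : ℕ) : ℝ :=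
  P.real {ω | ∀ i < n, X i ω ≤ x}

/-- `t` is the second of the three real roots, in increasing order, of `α t ^ 3 - t + 1 = 0`:
it is a root, and there are one root below it and one root above it. -/
def IsSecondRoot (α t : ℝ) : Prop :=
  α * t ^ 3 - t + 1 = 0 ∧
    (∃ s, s < t ∧ α * s ^ 3 - s + 1 = 0) ∧ (∃ s, t < s ∧ α * s ^ 3 - s + 1 = 0)

/-- The coefficient `K(α)`, for `l = l(α)`. -/
noncomputable def K (α l : ℝ) : ℝ :=
  ((11 - 3 * α) / (1 - α) ^ 2 +
      2 * l * (1 + 3 * α) *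
        ((2 + 3 * l * α - α * (2 - l * α) * (1 + l * α) ^ 2) /
          (1 - α * (1 + l * α) ^ 2) ^ 3)) /
    (1 - 2 * α * (1 + l * α) / (1 - α * (1 + l * α) ^ 2) ^ 2)

/-- The coefficient `L(α)`, for `l = l(α)`. -/
noncomputable def L (α l : ℝ) : ℝ :=
  3 * K α l * (1 + α + 3 * α ^ 2) * (1 + α + 3 * α ^ 2 + K α l * α ^ 3) + α ^ 6 * K α l ^ 3 +
    9 * α * (4 + 3 * α + 3 * α ^ 2) + 55

/-- The coefficient `E(α)` as a function of `α` and `η`, where `η = 1 + l α`. -/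
noncomputable def E (α η : ℝ) : ℝ :=
  0.1 +
    (η ^ 5 * (1 + (1 - 2 * α) * η) ^ 4 * (1 + α * (η - 2)) * (1 + η + (1 - 3 * α) * η ^ 2)) /
      (2 * (1 - α * η ^ 2) ^ 4 *
        ((1 - α * η ^ 2) ^ 2 - α * η ^ 2 * (1 + η - 2 * α * η) ^ 2))

/-- The coefficient `Γ(α) = L(α) + E(α)`, for `l = l(α)`. -/
noncomputable def Gam (α l : ℝ) : ℝ :=
  L α l + E α (1 + l * α)

/-- The coefficient `Δ₂(α, n, q₁)`, for `l = l(α)`. -/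
noncomputable def Delta2 (α l : ℝ) (n : ℕ) (q₁ : ℝ) : ℝ :=
  3 + Gam α l * (1 - q₁) + n * (1 + K α l * (1 - q₁))

end OneDep

/-! Let p and s be the probabilities that one, respectively two consecutive, variables exceed x, and
put d = p - s. Splitting according to the run of exceedances at the end gives q_{n+2} - q_{n+3} = p
q_{n+1} - s q_n + A with 0 ≤ A ≤ p² (`exists_q_sub_q_succ_eq`). So every decrement is d q_n up to
O(p²). Feeding this back into the recurrence shows that ν = 1 + d + 2d² satisfies |ν q_{n+1} - q_n|
≤ p²(1 + 7p) (`abs_mul_succ_sub_le`). Since ν ≥ 1, these errors at most add up over n steps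
(`abs_sub_div_pow_le`), giving n p²(1 + 7p).

No generating function or root expansion is needed. The coefficients enter only through K ≥ 11 > 7
and Γ ≥ 0, so the summand 3 + Γp is pure slack. -/

namespace OneDep

/-! ### Exceedance probabilities and the recurrence for q. -/

section Probability

variable {Ω : Type*} [MeasurableSpace Ω] {P : Measure Ω} {X : ℕ → Ω → ℝ} {x : ℝ}

lemma StrictlyStationary.measureReal_shift (hstat : StrictlyStationary P X)
    (hX : ∀ i, Measurable (X i)) (n k : ℕ) {S : Set (Fin n → ℝ)} (hS : MeasurableSet S) :
    P.real {ω | (fun i : Fin n => X (k + i) ω) ∈ S} =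
      P.real {ω | (fun i : Fin n => X i ω) ∈ S} := by
  have h := congrArg (fun μ => μ.real S) (hstat n k)
  beta_reduce at h
  rwa [map_measureReal_apply (measurable_pi_lambda _ fun i => hX _) hS,
    map_measureReal_apply (measurable_pi_lambda _ fun i => hX _) hS] at h

lemma StrictlyStationary.measureReal_lt (hstat : StrictlyStationary P X)
    (hX : ∀ i, Measurable (X i)) (k : ℕ) :
    P.real {ω | x < X k ω} = P.real {ω | x < X 0 ω} := by
  have hS : MeasurableSet {f : Fin 1 → ℝ | x < f 0} :=
    measurableSet_lt measurable_const (measurable_pi_apply 0)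
  simpa using hstat.measureReal_shift hX 1 k hS

lemma StrictlyStationary.measureReal_lt_lt (hstat : StrictlyStationary P X)
    (hX : ∀ i, Measurable (X i)) (k : ℕ) :
    P.real {ω | x < X k ω ∧ x < X (k + 1) ω} = P.real {ω | x < X 0 ω ∧ x < X 1 ω} := by
  have hS : MeasurableSet {f : Fin 2 → ℝ | x < f 0 ∧ x < f 1} :=
    (measurableSet_lt measurable_const (measurable_pi_apply 0)).inter
      (measurableSet_lt measurable_const (measurable_pi_apply 1))
  simpa using hstat.measureReal_shift hX 2 k hS

lemma OneDependent.measureReal_inter (hdep : OneDependent P X) {t : ℕ} (ht : 1 ≤ t) {A B : Set Ω}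
    (hA : MeasurableSet[⨆ i ∈ {i : ℕ | i < t}, MeasurableSpace.comap (X i) inferInstance] A)
    (hB : MeasurableSet[⨆ i ∈ {i : ℕ | t + 1 ≤ i}, MeasurableSpace.comap (X i) inferInstance] B) :
    P.real (A ∩ B) = P.real A * P.real B := by
  have h := (Indep_iff _ _ _).1 (hdep t ht) A B hA hB
  simp only [measureReal_def, h, ENNReal.toReal_mul]

omit [MeasurableSpace Ω] in
lemma measurableSet_iSup_comap_preimage {T : Set ℕ} {i : ℕ} (hi : i ∈ T) {S : Set ℝ}
    (hS : MeasurableSet S) :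
    MeasurableSet[⨆ i ∈ T, MeasurableSpace.comap (X i) inferInstance] (X i ⁻¹' S) :=
  le_iSup₂ (f := fun i (_ : i ∈ T) => MeasurableSpace.comap (X i) inferInstance) i hi _
    ⟨S, hS, rfl⟩

omit [MeasurableSpace Ω] in
lemma measurableSet_iSup_comap_lt {T : Set ℕ} {i : ℕ} (hi : i ∈ T) :
    MeasurableSet[⨆ i ∈ T, MeasurableSpace.comap (X i) inferInstance] {ω | x < X i ω} :=
  measurableSet_iSup_comap_preimage hi measurableSet_Ioi

omit [MeasurableSpace Ω] in
lemma measurableSet_iSup_comap_forall_le (n : ℕ) :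
    MeasurableSet[⨆ i ∈ {i : ℕ | i < n}, MeasurableSpace.comap (X i) inferInstance]
      {ω | ∀ i < n, X i ω ≤ x} := by
  have : {ω | ∀ i < n, X i ω ≤ x} = ⋂ i, ⋂ (_ : i < n), X i ⁻¹' Set.Iic x := by
    ext ω; simp
  rw [this]
  refine MeasurableSet.iInter fun i => MeasurableSet.iInter fun hi => ?_
  exact measurableSet_iSup_comap_preimage (T := {i : ℕ | i < n}) (by simpa using hi)
    measurableSet_Iic

lemma measureReal_inter_le_add_inter_lt [IsFiniteMeasure P] (hX : ∀ i, Measurable (X i))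
    (A : Set Ω) (k : ℕ) :
    P.real (A ∩ {ω | X k ω ≤ x}) + P.real (A ∩ {ω | x < X k ω}) = P.real A := by
  have hm : MeasurableSet {ω | X k ω ≤ x} := measurableSet_le (hX k) measurable_const
  have h := measureReal_inter_add_sdiff (μ := P) (s := A) hm
  rwa [show A \ {ω | X k ω ≤ x} = A ∩ {ω | x < X k ω} by ext ω; simp] at h

omit [MeasurableSpace Ω] in
lemma forall_lt_succ_le_eq_inter (n : ℕ) :
    {ω | ∀ i < n + 1, X i ω ≤ x} = {ω | ∀ i < n, X i ω ≤ x} ∩ {ω | X n ω ≤ x} := by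
  ext ω
  simp only [Set.mem_inter_iff, Set.mem_ofPred_eq, Nat.forall_lt_succ_right]

lemma q_zero [IsProbabilityMeasure P] : q P X x 0 = 1 := by simp [q]

lemma q_succ_add [IsFiniteMeasure P] (hX : ∀ i, Measurable (X i)) (n : ℕ) :
    q P X x (n + 1) + P.real ({ω | ∀ i < n, X i ω ≤ x} ∩ {ω | x < X n ω}) = q P X x n := by
  unfold q
  rw [forall_lt_succ_le_eq_inter]
  exact measureReal_inter_le_add_inter_lt hX _ n

lemma q_one_add [IsProbabilityMeasure P] (hX : ∀ i, Measurable (X i)) :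
    q P X x 1 + P.real {ω | x < X 0 ω} = 1 := by
  have h := q_succ_add (P := P) (x := x) hX 0
  rw [q_zero] at h
  simpa using h

lemma q_two [IsProbabilityMeasure P] (hX : ∀ i, Measurable (X i))
    (hstat : StrictlyStationary P X) :
    q P X x 1 - q P X x 2 =
      P.real {ω | x < X 0 ω} - P.real {ω | x < X 0 ω ∧ x < X 1 ω} := by
  have h := q_succ_add (P := P) (x := x) hX 1
  have h2 := measureReal_inter_le_add_inter_lt (P := P) (x := x) hX {ω | x < X 1 ω} 0
  rw [hstat.measureReal_lt hX 1] at h2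
  have e1 : {ω | ∀ i < 1, X i ω ≤ x} ∩ {ω | x < X 1 ω} = {ω | x < X 1 ω} ∩ {ω | X 0 ω ≤ x} := by
    ext ω; simp [and_comm]
  have e2 : {ω | x < X 1 ω} ∩ {ω | x < X 0 ω} = {ω | x < X 0 ω ∧ x < X 1 ω} := by
    ext ω; simp [and_comm]
  rw [e1] at h
  rw [e2] at h2
  linarith

lemma measureReal_forall_le_inter_lt [IsProbabilityMeasure P] (hX : ∀ i, Measurable (X i))
    (hstat : StrictlyStationary P X) (hdep : OneDependent P X) (n : ℕ) :
    P.real ({ω | ∀ i < n, X i ω ≤ x} ∩ {ω | x < X (n + 1) ω}) =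
      q P X x n * P.real {ω | x < X 0 ω} := by
  rcases Nat.eq_zero_or_pos n with rfl | hn
  · simpa [q_zero] using hstat.measureReal_lt hX 1
  · rw [hdep.measureReal_inter hn (measurableSet_iSup_comap_forall_le n)
      (measurableSet_iSup_comap_lt (i := n + 1) (by simp)),
      ← hstat.measureReal_lt hX (n + 1)]
    rfl

lemma measureReal_forall_le_inter_lt_lt [IsProbabilityMeasure P] (hX : ∀ i, Measurable (X i))
    (hstat : StrictlyStationary P X) (hdep : OneDependent P X) (n : ℕ) :
    P.real ({ω | ∀ i < n, X i ω ≤ x} ∩ {ω | x < X (n + 1) ω ∧ x < X (n + 2) ω}) =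
      q P X x n * P.real {ω | x < X 0 ω ∧ x < X 1 ω} := by
  rcases Nat.eq_zero_or_pos n with rfl | hn
  · simpa [q_zero] using hstat.measureReal_lt_lt hX 1
  · have e : {ω | x < X (n + 1) ω ∧ x < X (n + 2) ω} =
        {ω | x < X (n + 1) ω} ∩ {ω | x < X (n + 2) ω} := by
      ext ω; simp
    rw [e, hdep.measureReal_inter hn (measurableSet_iSup_comap_forall_le n)
      ((measurableSet_iSup_comap_lt (i := n + 1) (by simp)).inter
        (measurableSet_iSup_comap_lt (i := n + 2) (by simp))),
      ← e, ← hstat.measureReal_lt_lt hX (n + 1)]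
    rfl

lemma measureReal_lt_inter_lt (hX : ∀ i, Measurable (X i))
    (hstat : StrictlyStationary P X) (hdep : OneDependent P X) (n : ℕ) :
    P.real ({ω | x < X n ω} ∩ {ω | x < X (n + 2) ω}) = P.real {ω | x < X 0 ω} ^ 2 := by
  rw [hdep.measureReal_inter (t := n + 1) (by omega)
    (measurableSet_iSup_comap_lt (i := n) (by simp))
    (measurableSet_iSup_comap_lt (i := n + 2) (by simp)), sq]
  exact congrArg₂ _ (hstat.measureReal_lt hX n) (hstat.measureReal_lt hX (n + 2))

lemma q_sub_q_succ_mem_Icc [IsProbabilityMeasure P] (hX : ∀ i, Measurable (X i))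
    (hstat : StrictlyStationary P X) (n : ℕ) :
    q P X x n - q P X x (n + 1) ∈ Set.Icc 0 (P.real {ω | x < X 0 ω}) := by
  have h := q_succ_add (P := P) (x := x) hX n
  have h1 : P.real ({ω | ∀ i < n, X i ω ≤ x} ∩ {ω | x < X n ω}) ≤ P.real {ω | x < X n ω} :=
    measureReal_mono Set.inter_subset_right
  rw [hstat.measureReal_lt hX n] at h1
  have h2 : 0 ≤ P.real ({ω | ∀ i < n, X i ω ≤ x} ∩ {ω | x < X n ω}) := measureReal_nonneg
  constructor <;> linarith

/-- Inclusion-exclusion over the length of the run of exceedances that ends at a given time,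
stopped after two terms. -/
lemma exists_q_sub_q_succ_eq [IsProbabilityMeasure P] (hX : ∀ i, Measurable (X i))
    (hstat : StrictlyStationary P X) (hdep : OneDependent P X) (n : ℕ) :
    ∃ A ∈ Set.Icc 0 (P.real {ω | x < X 0 ω} ^ 2),
      q P X x (n + 2) - q P X x (n + 3) = P.real {ω | x < X 0 ω} * q P X x (n + 1) -
        P.real {ω | x < X 0 ω ∧ x < X 1 ω} * q P X x n + A := by
  set G : ℕ → Set Ω := fun n => {ω | ∀ i < n, X i ω ≤ x} with hG
  -- The remainder is the event of three final exceedances. Dropping the middle one leaves two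
  -- variables at distance 2, which are independent, hence the bound p².
  refine ⟨P.real ((G n ∩ {ω | x < X (n + 1) ω ∧ x < X (n + 2) ω}) ∩ {ω | x < X n ω}),
    ⟨measureReal_nonneg, ?_⟩, ?_⟩
  · rw [← measureReal_lt_inter_lt hX hstat hdep n]
    exact measureReal_mono fun ω hω => ⟨hω.2, hω.1.2.2⟩
  · have h0 := q_succ_add (P := P) (x := x) hX (n + 2)
    have h1 := measureReal_inter_le_add_inter_lt (P := P) (x := x) hX
      (G (n + 1) ∩ {ω | x < X (n + 2) ω}) (n + 1)
    have h2 := measureReal_inter_le_add_inter_lt (P := P) (x := x) hX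
      (G n ∩ {ω | x < X (n + 1) ω ∧ x < X (n + 2) ω}) n
    have i1 := measureReal_forall_le_inter_lt (x := x) hX hstat hdep (n + 1)
    have i2 := measureReal_forall_le_inter_lt_lt (x := x) hX hstat hdep n
    have e1 : G (n + 1) ∩ {ω | x < X (n + 2) ω} ∩ {ω | X (n + 1) ω ≤ x} =
        G (n + 2) ∩ {ω | x < X (n + 2) ω} := by
      simp only [hG]
      rw [forall_lt_succ_le_eq_inter (n + 1), Set.inter_right_comm]
    have e2 : G n ∩ {ω | x < X (n + 1) ω ∧ x < X (n + 2) ω} ∩ {ω | X n ω ≤ x} =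
        G (n + 1) ∩ {ω | x < X (n + 2) ω} ∩ {ω | x < X (n + 1) ω} := by
      simp only [hG]
      rw [forall_lt_succ_le_eq_inter n]
      ext ω
      simp only [Set.mem_inter_iff, Set.mem_ofPred_eq]
      tauto
    rw [e1] at h1
    rw [e2] at h2
    simp only [hG] at h1 h2 ⊢
    linarith

end Probability

/-! ### Deterministic analysis of the perturbed recurrence. -/

section Recurrence

variable {p s : ℝ} {u : ℕ → ℝ}

/-- One step of the recurrence: with `A` the remainder and `e₁, e₂, e₃` the deviations of three
consecutive decrements from `(p - s) * Q`. -/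
lemma abs_mul_sub_le_of_deviations {Q A e₁ e₂ e₃ : ℝ} (hs : 0 ≤ s) (hsp : s ≤ p)
    (hQ : Q ∈ Set.Icc 0 1) (hA : A ∈ Set.Icc 0 (p ^ 2))
    (h₁ : e₁ ∈ Set.Icc (-(3 * p * s)) (3 * p ^ 2)) (h₂ : e₂ ∈ Set.Icc (-(4 * p * s)) (4 * p ^ 2))
    (h₃ : e₃ ∈ Set.Icc (-(5 * p * s)) (5 * p ^ 2)) :
    |Q * s * (p - s) - A - (p - s) * (e₁ + e₂) + s * e₃| ≤ p ^ 2 * (1 + 7 * p) := by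
  obtain ⟨hQ0, hQ1⟩ := hQ
  obtain ⟨hA0, hA1⟩ := hA
  have hd : 0 ≤ p - s := sub_nonneg.2 hsp
  have hp : 0 ≤ p := hs.trans hsp
  have hsd : 0 ≤ s * (p - s) := mul_nonneg hs hd
  -- The 7 is 3 + 4, from `h₁` and `h₂`.
  have a1 : (p - s) * (e₁ + e₂) ≤ (p - s) * (7 * p ^ 2) :=
    mul_le_mul_of_nonneg_left (by linarith [h₁.2, h₂.2]) hd
  have a2 : (p - s) * -(7 * p * s) ≤ (p - s) * (e₁ + e₂) :=
    mul_le_mul_of_nonneg_left (by linarith [h₁.1, h₂.1]) hd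
  have a3 : s * e₃ ≤ s * (5 * p ^ 2) := mul_le_mul_of_nonneg_left h₃.2 hs
  have a4 : s * -(5 * p * s) ≤ s * e₃ := mul_le_mul_of_nonneg_left h₃.1 hs
  have a5 : Q * (s * (p - s)) ≤ 1 * (s * (p - s)) := mul_le_mul_of_nonneg_right hQ1 hsd
  have a6 : 0 ≤ Q * (s * (p - s)) := mul_nonneg hQ0 hsd
  have hsd' : s * (p - s) ≤ p ^ 2 := by nlinarith
  have b1 : 0 ≤ p * (s * (p - s)) := mul_nonneg hp hsd
  have b2 : 0 ≤ p * (p - s) ^ 2 := by positivity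
  rw [abs_le]
  constructor
  · nlinarith [mul_nonneg (mul_nonneg hp hs) hd]
  · nlinarith

/-- With Q the latest value and dQ + eᵢ the last three decrements (d = p - s), the recurrence gives
e₁ = 2d²Q + d(e₁ + e₂) - s(dQ + e₃) + A. The term 2d² in the multiplier cancels 2d²Q, which leaves
the expression bounded in `abs_mul_sub_le_of_deviations`. -/
lemma abs_mul_succ_sub_le (hs : 0 ≤ s) (hsp : s ≤ p)
    (hp1 : p ≤ 1 / 10) (h0 : u 0 = 1) (h1 : u 1 = 1 - p) (h2 : u 1 - u 2 = p - s)
    (hu : ∀ n, 0 ≤ u n) (hstep : ∀ n, u n - u (n + 1) ∈ Set.Icc 0 p)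
    (hrec : ∀ n, ∃ A ∈ Set.Icc 0 (p ^ 2), u (n + 2) - u (n + 3) = p * u (n + 1) - s * u n + A)
    (n : ℕ) :
    |(1 + (p - s) + 2 * (p - s) ^ 2) * u (n + 2) - u (n + 1)| ≤ p ^ 2 * (1 + 7 * p) := by
  have hd : 0 ≤ p - s := sub_nonneg.2 hsp
  have hp : 0 ≤ p := hs.trans hsp
  have hsd : 0 ≤ s * (p - s) := mul_nonneg hs hd
  match n with
  -- The first two cases precede the range where the recurrence can be used twice; they are computed
  -- explicitly.
  | 0 =>
    have h2' : u 2 = 1 - 2 * p + s := by linarith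
    have e : (1 + (p - s) + 2 * (p - s) ^ 2) * u (0 + 2) - u (0 + 1) =
        -(s * (p - s)) - (2 * p - s) * (2 * (p - s) ^ 2) := by
      simp only [zero_add, h1, h2']; ring
    have b : 0 ≤ (2 * p - s) * (2 * (p - s) ^ 2) := mul_nonneg (by linarith) (by positivity)
    have b' : (2 * p - s) * (2 * (p - s) ^ 2) ≤ (2 * p) * (2 * p ^ 2) := by
      gcongr <;> linarith
    have hp3 : 0 ≤ p ^ 3 := by positivity
    rw [e, abs_le]
    constructor <;> nlinarith
  | 1 =>
    obtain ⟨A, ⟨hA0, hA1⟩, hA⟩ := hrec 0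
    have h2' : u 2 = 1 - 2 * p + s := by linarith
    have h3 : u 3 = 1 - 3 * p + 2 * s + p ^ 2 - A := by
      simp only [zero_add, h0, h1, h2'] at hA; linarith
    have e : (1 + (p - s) + 2 * (p - s) ^ 2) * u (1 + 2) - u (1 + 1) =
        p * s - A + (p ^ 2 - A) * ((p - s) + 2 * (p - s) ^ 2) -
          (3 * p - 2 * s) * (2 * (p - s) ^ 2) := by
      simp only [Nat.reduceAdd, h2', h3]; ring
    have b : 0 ≤ (3 * p - 2 * s) * (2 * (p - s) ^ 2) := mul_nonneg (by linarith) (by positivity)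
    have b' : (3 * p - 2 * s) * (2 * (p - s) ^ 2) ≤ (3 * p) * (2 * p ^ 2) := by
      gcongr <;> linarith
    have c : 0 ≤ (p ^ 2 - A) * ((p - s) + 2 * (p - s) ^ 2) :=
      mul_nonneg (by linarith) (by positivity)
    have hw : (p - s) + 2 * (p - s) ^ 2 ≤ 2 * p := by nlinarith
    have c' : (p ^ 2 - A) * ((p - s) + 2 * (p - s) ^ 2) ≤ p ^ 2 * (2 * p) := by
      gcongr; linarith
    have hp3 : 0 ≤ p ^ 3 := by positivity
    have hps : 0 ≤ p * s := mul_nonneg hp hs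
    have hps' : p * s ≤ p * p := mul_le_mul_of_nonneg_left hsp hp
    rw [e, abs_le]
    constructor <;> nlinarith
  | m + 2 =>
    obtain ⟨A₁, hA₁, r₁⟩ := hrec (m + 1)
    obtain ⟨A₂, hA₂, r₂⟩ := hrec m
    -- Here `y` plays the role of u_{m-1}; at m = 0 the value u_{-1} = 1 with zero remainder keeps
    -- the recurrence true.
    obtain ⟨y, A₃, hA₃, hy, r₃⟩ : ∃ y, ∃ A ∈ Set.Icc 0 (p ^ 2), y - u m ∈ Set.Icc 0 p ∧
        u (m + 1) - u (m + 2) = p * u m - s * y + A := by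
      cases m with
      | zero => exact ⟨1, 0, ⟨le_rfl, by positivity⟩, by simp [h0, hp], by simp [h0, h2]⟩
      | succ k =>
        obtain ⟨A, hA, r⟩ := hrec k
        exact ⟨u k, A, hA, hstep k, r⟩
    have s0 := hstep m
    have s1 := hstep (m + 1)
    have s2 := hstep (m + 2)
    have s3 := hstep (m + 3)
    have hle : u (m + 4) ≤ 1 := by
      have : Antitone u := antitone_nat_of_succ_le fun k => sub_nonneg.1 (hstep k).1
      exact h0 ▸ this (Nat.zero_le _)
    -- A decrement minus (p - s)Q is p a - s b + A, where a and b are drops down to Q; they are at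
    -- most p per step.
    have dev : ∀ {a b A c : ℝ}, A ∈ Set.Icc 0 (p ^ 2) → 0 ≤ a → a ≤ c * p → 0 ≤ b →
        b ≤ (c + 1) * p →
        p * a - s * b + A ∈ Set.Icc (-((c + 1) * p * s)) ((c + 1) * p ^ 2) := by
      intro a b A c hA ha ha' hb hb'
      have k1 := mul_le_mul_of_nonneg_left ha' hp
      have k2 := mul_le_mul_of_nonneg_left hb' hs
      have k3 := mul_nonneg hp ha
      have k4 := mul_nonneg hs hb
      constructor <;> nlinarith [hA.1, hA.2]
    simp only [Set.mem_Icc, add_assoc, Nat.reduceAdd] at s0 s1 s2 s3 hy r₁ r₂ r₃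
    have d₁ := dev (a := u (m + 2) - u (m + 4)) (b := u (m + 1) - u (m + 4)) (c := 2) hA₁
      (by linarith) (by linarith) (by linarith) (by linarith)
    have d₂ := dev (a := u (m + 1) - u (m + 4)) (b := u m - u (m + 4)) (c := 3) hA₂
      (by linarith) (by linarith) (by linarith) (by linarith)
    have d₃ := dev (a := u m - u (m + 4)) (b := y - u (m + 4)) (c := 4) hA₃
      (by linarith) (by linarith) (by linarith) (by linarith)
    norm_num only at d₁ d₂ d₃
    have key := abs_mul_sub_le_of_deviations hs hsp ⟨hu (m + 4), hle⟩ hA₁ d₁ d₂ d₃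
    convert key using 2
    simp only [add_assoc, Nat.reduceAdd]
    linear_combination (-1 - p + s) * r₁ + (s - p) * r₂ + s * r₃

/-- Dividing by a multiplier that is at least 1 never enlarges the accumulated error, so each step
adds at most p²(1 + 7p). -/
lemma abs_sub_div_pow_le (hs : 0 ≤ s) (hsp : s ≤ p)
    (hp1 : p ≤ 1 / 10) (h0 : u 0 = 1) (h1 : u 1 = 1 - p) (h2 : u 1 - u 2 = p - s)
    (hu : ∀ n, 0 ≤ u n) (hstep : ∀ n, u n - u (n + 1) ∈ Set.Icc 0 p)
    (hrec : ∀ n, ∃ A ∈ Set.Icc 0 (p ^ 2), u (n + 2) - u (n + 3) = p * u (n + 1) - s * u n + A)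
    (n : ℕ) :
    |u (n + 1) - (1 - s) / (1 + (p - s) + 2 * (p - s) ^ 2) ^ (n + 1)| ≤
      (n + 1) * (p ^ 2 * (1 + 7 * p)) := by
  have hd : 0 ≤ p - s := sub_nonneg.2 hsp
  have hp : 0 ≤ p := hs.trans hsp
  have hstep' := abs_mul_succ_sub_le hs hsp hp1 h0 h1 h2 hu hstep hrec
  have hν : 1 ≤ 1 + (p - s) + 2 * (p - s) ^ 2 := by nlinarith
  induction n with
  | zero =>
    set ν := 1 + (p - s) + 2 * (p - s) ^ 2 with hνdef
    have hpos : 0 < ν := by linarith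
    have e : u (0 + 1) - (1 - s) / ν ^ (0 + 1) = (ν * (1 - p) - (1 - s)) / ν := by
      rw [zero_add, pow_one, h1]; field_simp
    rw [e, abs_div, abs_of_pos hpos]
    refine (div_le_self (abs_nonneg _) hν).trans ?_
    have hsd : 0 ≤ s * (p - s) := mul_nonneg hs hd
    have hp3 : 0 ≤ p ^ 3 := by positivity
    have b : 0 ≤ p * (2 * (p - s) ^ 2) := by positivity
    have b' : p * (2 * (p - s) ^ 2) ≤ p * (2 * p ^ 2) := by gcongr; linarith
    rw [hνdef, abs_le]
    constructor <;> push_cast <;> nlinarith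
  | succ n ih =>
    have hstep'' := hstep' n
    set ν := 1 + (p - s) + 2 * (p - s) ^ 2
    have hpos : 0 < ν := by linarith
    have e : u (n + 1 + 1) - (1 - s) / ν ^ (n + 1 + 1) =
        ((ν * u (n + 2) - u (n + 1)) + (u (n + 1) - (1 - s) / ν ^ (n + 1))) / ν := by
      field_simp; ring
    rw [e, abs_div, abs_of_pos hpos]
    refine (div_le_self (abs_nonneg _) hν).trans ((abs_add_le _ _).trans ?_)
    push_cast
    linarith

end Recurrence

/-! ### Numerical bounds on the coefficients. -/

section Coefficients

variable {α t l : ℝ}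

/-- By Vieta the roots sum to 0, and the middle one is positive with 3αt² < 1. Hence t = 1 + αt³ < 1
+ t/3, so t < 1.5. On [1.16, 1.5] the cubic is negative, already at α = 1/10. -/
lemma IsSecondRoot.mem_Ioo (hα : 0 < α) (hα' : α ≤ 1 / 10) (h : IsSecondRoot α t) :
    t ∈ Set.Ioo 1 1.16 := by
  obtain ⟨ht, ⟨a, hat, ha⟩, ⟨b, htb, hb⟩⟩ := h
  have e1 : α * (a ^ 2 + a * t + t ^ 2) = 1 :=
    mul_left_cancel₀ (sub_ne_zero.2 hat.ne) (by linear_combination ha - ht)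
  have e2 : α * (b ^ 2 + b * t + t ^ 2) = 1 :=
    mul_left_cancel₀ (sub_ne_zero.2 htb.ne') (by linear_combination hb - ht)
  have e3 : a + b + t = 0 :=
    mul_left_cancel₀ (mul_ne_zero hα.ne' (sub_ne_zero.2 (hat.trans htb).ne))
      (by linear_combination e1 - e2)
  obtain rfl : a = -(b + t) := by linarith
  have hb0 : 0 < b := by linarith
  have e4 : α * (b * t * (b + t)) = 1 := by linear_combination t * e2 - ht
  have ht0 : 0 < t := by
    by_contra! hneg
    have : b * t * (b + t) ≤ 0 :=
      mul_nonpos_of_nonpos_of_nonneg (mul_nonpos_of_nonneg_of_nonpos hb0.le hneg) (by linarith)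
    nlinarith
  have ht3 : 3 * (α * t ^ 2) < 1 := by
    have : 3 * t ^ 2 < b ^ 2 + b * t + t ^ 2 := by nlinarith
    nlinarith
  have ht1 : 1 < t := by nlinarith [mul_pos hα (pow_pos ht0 3)]
  have ht2 : t < 1.5 := by nlinarith
  refine ⟨ht1, ?_⟩
  by_contra! hge
  have : α * t ^ 3 ≤ 1 / 10 * t ^ 3 := by gcongr
  nlinarith [mul_nonneg (sub_nonneg.2 hge) (sub_nonneg.2 ht2.le)]

lemma mul_lt_of_isSecondRoot (hα : 0 < α) (hα' : α ≤ 1 / 10) (h : IsSecondRoot α t)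
    (hl : t + (l - t ^ 3) < 1 / √(3 * α)) : l * α < 0.223 := by
  obtain ⟨h1, h2⟩ := h.mem_Ioo hα hα'
  have hw : 0 < √(3 * α) := Real.sqrt_pos.2 (by linarith)
  have hw2 : √(3 * α) ^ 2 = 3 * α := Real.sq_sqrt (by linarith)
  set w := √(3 * α)
  have hw1 : w < 0.548 := by nlinarith
  have hlt : (t + (l - t ^ 3)) * w < 1 := by rwa [lt_div_iff₀ hw] at hl
  -- Then lα = (t + l - t³)α + α(t³ - t) is below 0.548/3 + 0.0401 < 0.223.
  have h3 : (t + (l - t ^ 3)) * α < w / 3 := by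
    have e : (t + (l - t ^ 3)) * α = (t + (l - t ^ 3)) * w * (w / 3) := by
      linear_combination (-(t + (l - t ^ 3)) / 3) * hw2
    rw [e]
    exact (mul_lt_iff_lt_one_left (by positivity)).2 hlt
  have h4 : t ^ 3 - t < 0.401 := by
    nlinarith [mul_pos (sub_pos.2 h1) (sub_pos.2 h2)]
  have h5 : α * (t ^ 3 - t) ≤ 1 / 10 * 0.401 :=
    mul_le_mul hα' h4.le (by nlinarith [mul_pos (sub_pos.2 h1) (mul_pos (zero_lt_one.trans h1)
      (add_pos (zero_lt_one.trans h1) one_pos))]) (by norm_num)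
  linarith

/-- The first summand of the numerator is at least 11, the second is nonnegative, and the
denominator lies in (0, 1]. -/
lemma eleven_le_K (hα : 0 < α) (hα' : α ≤ 1 / 10) (hl : 0 < l) (hl' : l * α < 0.223) :
    11 ≤ K α l := by
  have hz : 0 < l * α := mul_pos hl hα
  have hη2 : (1 + l * α) ^ 2 < 1.5 := by nlinarith
  have hη0 : 0 < (1 + l * α) ^ 2 := by positivity
  have hc0 : 0 < α * (1 + l * α) ^ 2 := by positivity
  have hc : α * (1 + l * α) ^ 2 ≤ 0.15 := by nlinarith
  have hD : (0.85 : ℝ) ^ 2 ≤ (1 - α * (1 + l * α) ^ 2) ^ 2 := by gcongr; linarith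
  have hden : 2 * α * (1 + l * α) / (1 - α * (1 + l * α) ^ 2) ^ 2 < 1 := by
    rw [div_lt_one (by positivity)]
    nlinarith
  have hden0 : 0 ≤ 2 * α * (1 + l * α) / (1 - α * (1 + l * α) ^ 2) ^ 2 := by positivity
  have hfirst : 11 ≤ (11 - 3 * α) / (1 - α) ^ 2 := by
    rw [le_div_iff₀ (by nlinarith)]
    nlinarith
  have hN : 0 ≤ 2 + 3 * l * α - α * (2 - l * α) * (1 + l * α) ^ 2 := by nlinarith
  have hsecond : 0 ≤ 2 * l * (1 + 3 * α) *
      ((2 + 3 * l * α - α * (2 - l * α) * (1 + l * α) ^ 2) /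
        (1 - α * (1 + l * α) ^ 2) ^ 3) := by
    have : 0 < 1 - α * (1 + l * α) ^ 2 := by linarith
    positivity
  unfold K
  rw [le_div_iff₀ (by linarith)]
  linarith

lemma L_nonneg (hα : 0 < α) (hK : 0 ≤ K α l) : 0 ≤ L α l := by
  unfold L
  positivity

/-- The delicate factor is the difference in the denominator: its first term is at least 0.85042² ≈
0.723, the subtracted one at most about 0.586. -/
lemma E_nonneg {η : ℝ} (hα : 0 < α) (hα' : α ≤ 1 / 10) (hη : 1 ≤ η) (hη' : η ≤ 1.223) :
    0 ≤ E α η := by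
  have hη2 : η ^ 2 ≤ 1.4958 := by nlinarith
  have hc : α * η ^ 2 ≤ 0.14958 := by nlinarith [sq_nonneg η]
  have hD : (0.85042 : ℝ) ^ 2 ≤ (1 - α * η ^ 2) ^ 2 := by gcongr; linarith
  have hA : α * (1 + η - 2 * α * η) ^ 2 ≤ 1 / 10 * (1 + 0.8 * η) ^ 2 := by
    -- The left side is largest at α = 1/10; expanding in the defect k exhibits the difference as k
    -- times a nonnegative factor.
    obtain ⟨k, rfl⟩ : ∃ k, α = 1 / 10 - k := ⟨1 / 10 - α, by ring⟩
    have hk : 0 ≤ k := by linarith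
    have e : 1 / 10 * (1 + 0.8 * η) ^ 2 - (1 / 10 - k) * (1 + η - 2 * (1 / 10 - k) * η) ^ 2 =
        k * ((1 + 0.8 * η) * (1 + 0.4 * η) - 0.4 * (k * η ^ 2) +
          4 * (k * η * (1 + 0.8 * η)) + 4 * (k * η) ^ 2) := by ring
    have : 0 ≤ k * ((1 + 0.8 * η) * (1 + 0.4 * η) - 0.4 * (k * η ^ 2) +
          4 * (k * η * (1 + 0.8 * η)) + 4 * (k * η) ^ 2) := by
      have h1 : 0 ≤ k * η * (1 + 0.8 * η) := by positivity
      have h2 : k * η ^ 2 ≤ 1 / 10 * η ^ 2 := by gcongr; linarith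
      refine mul_nonneg hk ?_
      nlinarith [sq_nonneg (k * η)]
    linarith
  have hB : (1 + 0.8 * η) ^ 2 ≤ (1.9784 : ℝ) ^ 2 := by gcongr; linarith
  have hM : α * η ^ 2 * (1 + η - 2 * α * η) ^ 2 ≤ 1.4958 * (1 / 10 * 1.9784 ^ 2) := by
    have : α * η ^ 2 * (1 + η - 2 * α * η) ^ 2 = η ^ 2 * (α * (1 + η - 2 * α * η) ^ 2) := by ring
    rw [this]
    refine mul_le_mul hη2 (hA.trans (by linarith)) (by positivity) (by norm_num)
  have hden : 0 ≤ (1 - α * η ^ 2) ^ 2 - α * η ^ 2 * (1 + η - 2 * α * η) ^ 2 := by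
    norm_num at hD hM ⊢
    linarith
  have h1 : 0 ≤ 1 + α * (η - 2) := by nlinarith
  have h2 : 0 ≤ 1 + η + (1 - 3 * α) * η ^ 2 := by
    have : 0 ≤ 1 - 3 * α := by linarith
    positivity
  unfold E
  positivity

end Coefficients

end OneDep

/-! ### Assembly: comparison of n p²(1 + 7p) with the stated bound. -/

theorem theoremT4 {Ω : Type*} [MeasurableSpace Ω] (P : Measure Ω) [IsProbabilityMeasure P]
    (X : ℕ → Ω → ℝ) (hX : ∀ i, Measurable (X i))
    (hstat : OneDep.StrictlyStationary P X) (hdep : OneDep.OneDependent P X)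
    (α t₂ l x : ℝ) (hα : 0 < α) (hα' : (0.9 : ℝ) ≤ 1 - α)
    (ht₂ : OneDep.IsSecondRoot α t₂)
    (hl : t₂ ^ 3 < l) (hl' : t₂ + (l - t₂ ^ 3) < 1 / √(3 * α))
    (hx : 1 - α ≤ OneDep.q P X x 1) (n : ℕ) (hn : 1 ≤ n) :
    |OneDep.q P X x n -
        (2 * OneDep.q P X x 1 - OneDep.q P X x 2) /
          (1 + OneDep.q P X x 1 - OneDep.q P X x 2 +
            2 * (OneDep.q P X x 1 - OneDep.q P X x 2) ^ 2) ^ n| ≤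
      OneDep.Delta2 α l n (OneDep.q P X x 1) * (1 - OneDep.q P X x 1) ^ 2 := by
  have hα1 : α ≤ 1 / 10 := by norm_num at hα' ⊢; linarith
  have hl0 : 0 < l := by
    have ht := (ht₂.mem_Ioo hα hα1).1
    exact lt_trans (by positivity) hl
  have hlα := OneDep.mul_lt_of_isSecondRoot hα hα1 ht₂ hl'
  have hK := OneDep.eleven_le_K hα hα1 hl0 hlα
  have hΓ : 0 ≤ OneDep.Gam α l :=
    add_nonneg (OneDep.L_nonneg hα (by linarith))
      (OneDep.E_nonneg hα hα1 (by nlinarith [mul_pos hl0 hα]) (by norm_num at hlα ⊢; linarith))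
  have hq1 := OneDep.q_one_add (P := P) (x := x) hX
  have hq2 := OneDep.q_two (P := P) (x := x) hX hstat
  have hsp : P.real {ω | x < X 0 ω ∧ x < X 1 ω} ≤ P.real {ω | x < X 0 ω} :=
    measureReal_mono fun ω hω => hω.1
  have hp : 0 ≤ P.real {ω | x < X 0 ω} := measureReal_nonneg
  obtain ⟨m, rfl⟩ := Nat.exists_eq_add_of_le' hn
  have key := OneDep.abs_sub_div_pow_le (u := OneDep.q P X x) measureReal_nonneg hsp (by linarith)
    OneDep.q_zero (by linarith) hq2 (fun _ => measureReal_nonneg)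
    (OneDep.q_sub_q_succ_mem_Icc hX hstat) (OneDep.exists_q_sub_q_succ_eq hX hstat hdep) m
  rw [← hq2, show 1 - P.real {ω | x < X 0 ω ∧ x < X 1 ω} =
    2 * OneDep.q P X x 1 - OneDep.q P X x 2 by linarith, ← add_sub_assoc] at key
  refine key.trans ?_
  rw [show 1 - OneDep.q P X x 1 = P.real {ω | x < X 0 ω} by linarith]
  unfold OneDep.Delta2
  rw [show 1 - OneDep.q P X x 1 = P.real {ω | x < X 0 ω} by linarith]
  set p := P.real {ω | x < X 0 ω}
  have h7 : (m + 1 : ℝ) * (1 + 7 * p) ≤ (m + 1) * (1 + OneDep.K α l * p) := by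
    gcongr; linarith
  have hΓp : 0 ≤ OneDep.Gam α l * p := mul_nonneg hΓ hp
  push_cast
  calc (m + 1 : ℝ) * (p ^ 2 * (1 + 7 * p)) = ((m + 1) * (1 + 7 * p)) * p ^ 2 := by ring
    _ ≤ _ := by gcongr; linarith
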